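/- For a complex square matrix $A$ write $\Re A=\tfrac12(A+A^*)$; $A$ is accretive if $\Re A\ge O$ and strictly accretive if $\Re A>O$, where $\le$ denotes the Loewner order. A block matrix $\begin{bmatrix}A&X\\Y^*&B\end{bmatrix}$ with $n\times n$ blocks is called APT (accretive partial transpose) if both it and its partial transpose $\begin{bmatrix}A&Y^*\\X&B\end{bmatrix}$ are accretive. For strictly accretive $A,B$ and $t\in[0,1]$ put $$A\sharp_t B=A^{1/2}\left(A^{-1/2}BA^{-1/2}\right)^tA^{1/2},\qquad \sharp=\sharp_{1/2},$$ with principal powers $M^t=\exp(t\log M)$, where $\log M$ is the principal logarithm, and let $|Z|=(Z^*Z)^{1/2}$. **Corollary.** Let $A,B,X,Y$ be complex $n\times n$ matrices with $A,B$ strictly accretive and such that $\begin{bmatrix}A&X\\Y^*&B\end{bmatrix}$ is APT. Let $V$ be a unitary matrix in a polar decomposition $\frac{X+Y}{2}=V\left|\frac{X+Y}{2}\right|$. Then for every $t\in[0,1]$, $$\left|\frac{X+Y}{2}\right|\le \Re\left(A\sharp_t(V^*BV)\right)\sharp\,\Re\left(A\sharp_{1-t}(V^*BV)\right)$$ and $$\left|\frac{X^*+Y^*}{2}\right|\le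 \Re\left((VAV^*)\sharp_t B\right)\sharp\,\Re\left((VAV^*)\sharp_{1-t}B\right).$$ -/

import Mathlib

open scoped Matrix MatrixOrder ComplexOrder Matrix.Norms.L2Operator ComplexStarModule

noncomputable section

/-- A complex square matrix `A` is accretive if `Re A = (A + A*) / 2` is positive semidefinite. -/
def IsAccretive {m : Type*} [Fintype m] (A : Matrix m m ℂ) : Prop :=
  (ℜ A : Matrix m m ℂ).PosSemidef

/-- A complex square matrix `A` is strictly accretive if `Re A = (A + A*) / 2` is positive
definite. -/
def IsStrictlyAccretive {m : Type*} [Fintype m] (A : Matrix m m ℂ) : Prop :=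
  (ℜ A : Matrix m m ℂ).PosDef

/-- The partial transpose of a block matrix: `[[A, X], [W, B]]` becomes `[[A, W], [X, B]]`. -/
def partialTranspose {m : Type*} (M : Matrix (m ⊕ m) (m ⊕ m) ℂ) : Matrix (m ⊕ m) (m ⊕ m) ℂ :=
  Matrix.fromBlocks M.toBlocks₁₁ M.toBlocks₂₁ M.toBlocks₁₂ M.toBlocks₂₂

/-- A block matrix is APT (accretive partial transpose) if both it and its partial transpose
are accretive. -/
def IsAPT {m : Type*} [Fintype m] (M : Matrix (m ⊕ m) (m ⊕ m) ℂ) : Prop :=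
  IsAccretive M ∧ IsAccretive (partialTranspose M)

/-- `L` is a principal logarithm of `M`: `exp L = M`, and every eigenvalue of `L` lies in the
strip `|Im z| < π`. If no eigenvalue of `M` lies on `(-∞, 0]`, exactly one such `L` exists. -/
def IsPrincipalLog {m : Type*} [Fintype m] [DecidableEq m] (M L : Matrix m m ℂ) : Prop :=
  NormedSpace.exp L = M ∧ ∀ z ∈ spectrum ℂ L, |z.im| < Real.pi

open Classical in
/-- The principal logarithm of a matrix without eigenvalues on `(-∞, 0]` (a junk value where
there is none). -/
def principalLog {m : Type*} [Fintype m] [DecidableEq m] (M : Matrix m m ℂ) : Matrix m m ℂ :=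
  if h : ∃ L, IsPrincipalLog M L then h.choose else 0

/-- The principal power `M ^ t = exp (t log M)` of a matrix without eigenvalues on `(-∞, 0]`,
that is, the function `z ↦ z ^ t` (principal branch) of the matrix `M`. -/
def principalPow {m : Type*} [Fintype m] [DecidableEq m] (M : Matrix m m ℂ) (t : ℝ) :
    Matrix m m ℂ :=
  NormedSpace.exp (t • principalLog M)

/-- The weighted geometric mean
`A ♯_t B = A ^ (1/2) (A ^ (-1/2) B A ^ (-1/2)) ^ t A ^ (1/2)` of strictly accretive matrices
(in particular, of positive definite matrices). -/
def geomMean {m : Type*} [Fintype m] [DecidableEq m] (t : ℝ) (A B : Matrix m m ℂ) :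
    Matrix m m ℂ :=
  principalPow A (1 / 2) *
    principalPow (principalPow A (-(1 / 2)) * B * principalPow A (-(1 / 2))) t *
    principalPow A (1 / 2)

end

/-! ### Spectra through common eigenvectors -/

section Eigenvectors

variable {m : Type*} [Fintype m] [DecidableEq m]

/-! Write `Z` for `(X + Y) / 2`. The quadratic form of the partial transpose says that `Zᴴ` couples
`A` and `B` in the sense of `IsAccretivePair`. Since `Zᴴ = |Z| Vᴴ`, the congruence by `diag(1, V)`
turns this into a pair with Hermitian coupling `|Z|` and diagonal blocks `A`, `Vᴴ B V`; a further
congruence by `diag(Vᴴ, Vᴴ)` gives the pair behind the second inequality.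

Now let `H` be Hermitian and couple `A` and `B`, and let `L = log(A⁻¹ B)`. By `geomMean_eq`, `A ♯_t
B = A exp(tL)`, and `A ♯_{1-t} B = B exp(-tL)`. The pair `(A exp(tL), B exp(-tL))` is `(A, B)` at `t
= 0` and `(B, A)` at `t = 1`, both coupled by `H`. `IsAccretivePair.interpolate` fills in the
interval: the admissible `t` form a closed set stable under midpoints. The midpoint is the limit of
a matrix arithmetic-harmonic mean iteration, each step of which keeps the coupling
(`IsAccretivePair.mean_left`).

Accretivity sees only real parts, so `H` also couples `Re(A ♯_t B)` and `Re(A ♯_{1-t} B)`. These are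
positive definite, and the extremal property of the geometric mean (`le_geomMean_half`) bounds `H`
by their mean.

The matrices need not be diagonalizable. Spectral facts are therefore read off on common
eigenvectors of commuting matrices, and the logarithm is built as an integral. -/

theorem mem_spectrum_of_mulVec_eq {M : Matrix m m ℂ} {v : m → ℂ} {z : ℂ} (hv : v ≠ 0)
    (h : M *ᵥ v = z • v) : z ∈ spectrum ℂ M := by
  rw [← Matrix.spectrum_toLin']
  exact (Module.End.hasEigenvalue_of_hasEigenvector
    (Module.End.hasEigenvector_iff.2 ⟨Module.End.mem_eigenspace_iff.2 (by simpa using h), hv⟩)).mem_spectrum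

/-- Every eigenvalue of a matrix `M` has an eigenvector that is also an eigenvector of a given
matrix commuting with `M`. -/
theorem exists_common_eigenvector {M N : Matrix m m ℂ} (h : Commute M N) {z : ℂ}
    (hz : z ∈ spectrum ℂ M) : ∃ v : m → ℂ, v ≠ 0 ∧ M *ᵥ v = z • v ∧ ∃ w : ℂ, N *ᵥ v = w • v := by
  rw [← Matrix.spectrum_toLin', ← Module.End.hasEigenvalue_iff_mem_spectrum] at hz
  have hc : Commute (Matrix.toLin' M) (Matrix.toLin' N) := by
    unfold Commute SemiconjBy
    rw [Module.End.mul_eq_comp, Module.End.mul_eq_comp, ← Matrix.toLin'_mul, h.eq,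
      Matrix.toLin'_mul]
  have hmap : ∀ x ∈ Module.End.eigenspace (Matrix.toLin' M) z,
      (Matrix.toLin' N) x ∈ Module.End.eigenspace (Matrix.toLin' M) z :=
    fun x hx ↦ Module.End.mapsTo_genEigenspace_of_comm hc z 1 hx
  have : Nontrivial (Module.End.eigenspace (Matrix.toLin' M) z) :=
    Submodule.nontrivial_iff_ne_bot.2 hz
  obtain ⟨w, hw⟩ := Module.End.exists_eigenvalue ((Matrix.toLin' N).restrict hmap)
  obtain ⟨v, hv⟩ := hw.exists_hasEigenvector
  refine ⟨v, fun h0 ↦ hv.2 (Subtype.ext h0), ?_, w, ?_⟩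
  · simpa using Module.End.mem_eigenspace_iff.1 v.2
  · simpa using congrArg Subtype.val hv.apply_eq_smul

theorem exists_eigenvector {M : Matrix m m ℂ} {z : ℂ} (hz : z ∈ spectrum ℂ M) :
    ∃ v : m → ℂ, v ≠ 0 ∧ M *ᵥ v = z • v := by
  obtain ⟨v, hv, h, -⟩ := exists_common_eigenvector (Commute.refl M) hz
  exact ⟨v, hv, h⟩

/-- The kernel of a singular `M` is invariant under `N`, hence contains an eigenvector of `N`.
Invertibility can thus be tested on the eigenvectors of `N`, where `M` is usually an explicit
scalar. -/
theorem isUnit_of_forall_eigenvector {M N : Matrix m m ℂ} (h : Commute M N)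
    (H : ∀ v ≠ 0, ∀ w : ℂ, N *ᵥ v = w • v → M *ᵥ v ≠ 0) : IsUnit M := by
  by_contra hM
  obtain ⟨v, hv, h0, w, hw⟩ := exists_common_eigenvector h ((spectrum.zero_mem_iff ℂ).2 hM)
  exact H v hv w hw (by simpa using h0)

theorem mulVec_inverse_of_mulVec_eq {M : Matrix m m ℂ} (hM : IsUnit M) {v : m → ℂ} {z : ℂ}
    (hz : z ≠ 0) (h : M *ᵥ v = z • v) : Ring.inverse M *ᵥ v = z⁻¹ • v := by
  have : Ring.inverse M *ᵥ (M *ᵥ v) = v := by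
    rw [Matrix.mulVec_mulVec, Ring.inverse_mul_cancel _ hM, Matrix.one_mulVec]
  rw [h, Matrix.mulVec_smul] at this
  rw [← this, smul_smul, inv_mul_cancel₀ hz, one_smul, this]

/-- Evaluation of a matrix at a vector, as a continuous linear map in the matrix. -/
noncomputable def mulVecCLM (v : m → ℂ) : Matrix m m ℂ →L[ℂ] (m → ℂ) :=
  LinearMap.toContinuousLinearMap
    { toFun := fun M ↦ M *ᵥ v
      map_add' := fun M N ↦ Matrix.add_mulVec M N v
      map_smul' := fun c M ↦ Matrix.smul_mulVec c M v }

omit [DecidableEq m] in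
@[simp]
theorem mulVecCLM_apply (v : m → ℂ) (M : Matrix m m ℂ) : mulVecCLM v M = M *ᵥ v := rfl

theorem pow_mulVec_of_mulVec_eq {M : Matrix m m ℂ} {v : m → ℂ} {z : ℂ} (h : M *ᵥ v = z • v)
    (k : ℕ) : M ^ k *ᵥ v = z ^ k • v := by
  induction k with
  | zero => simp
  | succ k ih => rw [pow_succ, ← Matrix.mulVec_mulVec, h, Matrix.mulVec_smul, ih, smul_smul,
      pow_succ']

theorem exp_mulVec_of_mulVec_eq {M : Matrix m m ℂ} {v : m → ℂ} {z : ℂ} (h : M *ᵥ v = z • v) :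
    NormedSpace.exp M *ᵥ v = Complex.exp z • v := by
  have h1 := (NormedSpace.exp_series_hasSum_exp' (𝕂 := ℂ) M).mapL (mulVecCLM v)
  have h2 := (NormedSpace.exp_series_hasSum_exp' (𝕂 := ℂ) z).smul_const v
  rw [← Complex.exp_eq_exp_ℂ] at h2
  refine h1.unique (h2.congr_fun ?_)
  intro k
  simp only [mulVecCLM_apply, Matrix.smul_mulVec, pow_mulVec_of_mulVec_eq h, smul_smul, smul_eq_mul]

theorem intervalIntegral_mulVec {f : ℝ → Matrix m m ℂ} {a b : ℝ}
    (hf : IntervalIntegrable f MeasureTheory.volume a b) (v : m → ℂ) :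
    (∫ s in a..b, f s) *ᵥ v = ∫ s in a..b, f s *ᵥ v :=
  ((mulVecCLM v).intervalIntegral_comp_comm hf).symm

theorem commute_intervalIntegral {f : ℝ → Matrix m m ℂ} {a b : ℝ} {N : Matrix m m ℂ}
    (hf : IntervalIntegrable f MeasureTheory.volume a b)
    (h : ∀ s ∈ Set.uIcc a b, Commute N (f s)) : Commute N (∫ s in a..b, f s) := by
  have h1 := (ContinuousLinearMap.mul ℂ (Matrix m m ℂ) N).intervalIntegral_comp_comm hf
  have h2 := ((ContinuousLinearMap.mul ℂ (Matrix m m ℂ)).flip N).intervalIntegral_comp_comm hf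
  simp only [ContinuousLinearMap.mul_apply', ContinuousLinearMap.flip_apply] at h1 h2
  unfold Commute SemiconjBy
  rw [← h1, ← h2]
  exact intervalIntegral.integral_congr fun s hs ↦ (h s hs).eq

theorem mul_intervalIntegral {f : ℝ → Matrix m m ℂ} {a b : ℝ} (N : Matrix m m ℂ)
    (hf : IntervalIntegrable f MeasureTheory.volume a b) :
    N * ∫ s in a..b, f s = ∫ s in a..b, N * f s :=
  ((ContinuousLinearMap.mul ℂ (Matrix m m ℂ) N).intervalIntegral_comp_comm hf).symm

end Eigenvectors

/-! ### Existence and uniqueness of the principal logarithm -/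

section PrincipalLog

variable {m : Type*} [Fintype m] [DecidableEq m]

theorem continuous_exp_smul (L : Matrix m m ℂ) :
    Continuous fun s : ℝ ↦ NormedSpace.exp (s • L) :=
  continuous_iff_continuousAt.2 fun s ↦ (hasDerivAt_exp_smul_const (𝕂 := ℝ) L s).continuousAt

/-- A matrix in the kernel of the exponential map vanishes if its eigenvalues do. -/
theorem eq_zero_of_exp_eq_one {D : Matrix m m ℂ} (h : NormedSpace.exp D = 1)
    (hD : ∀ z ∈ spectrum ℂ D, z = 0) : D = 0 := by
  have hint : IntervalIntegrable (fun s : ℝ ↦ NormedSpace.exp (s • D)) MeasureTheory.volume 0 1 :=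
    (continuous_exp_smul D).intervalIntegrable 0 1
  -- The product is `exp D - 1`, by integrating the derivative of `exp(sD)`.
  have h1 : D * ∫ s in (0 : ℝ)..1, NormedSpace.exp (s • D) = 0 := by
    rw [mul_intervalIntegral D hint, intervalIntegral.integral_eq_sub_of_hasDerivAt
      (f := fun s : ℝ ↦ NormedSpace.exp (s • D)) (fun s _ ↦ ?_)]
    · simp [h]
    · exact (continuous_const.mul (continuous_exp_smul D)).intervalIntegrable 0 1
    · exact hasDerivAt_exp_smul_const' (𝕂 := ℝ) D s
  -- An eigenvector of `D` has eigenvalue `0`, so each `exp(sD)` fixes it, and so does the integral.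
  have hu : IsUnit (∫ s in (0 : ℝ)..1, NormedSpace.exp (s • D)) := by
    refine isUnit_of_forall_eigenvector (N := D) ?_ ?_
    · refine (commute_intervalIntegral hint fun s _ ↦ ?_).symm
      exact (Commute.refl D).smul_right s |>.exp_right
    · intro v hv w hw h0
      obtain rfl := hD w (mem_spectrum_of_mulVec_eq hv hw)
      rw [intervalIntegral_mulVec hint] at h0
      have : ∀ s : ℝ, NormedSpace.exp (s • D) *ᵥ v = v := fun s ↦ by
        rw [exp_mulVec_of_mulVec_eq (z := 0)]
        · simp
        · rw [Matrix.smul_mulVec, hw]; simp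
      simp only [this] at h0
      exact hv (by simpa using h0)
  exact hu.mul_left_eq_zero.1 h1

theorem one_add_smul_sub_one_mem_slitPlane {z : ℂ} (hz : z ∈ Complex.slitPlane) {s : ℝ}
    (hs : s ∈ Set.Icc (0 : ℝ) 1) : 1 + (s : ℂ) * (z - 1) ∈ Complex.slitPlane := by
  have := Complex.starConvex_one_slitPlane.add_smul_sub_mem hz hs.1 hs.2
  simpa using this

theorem intervalIntegral_log {z : ℂ} (hz : z ∈ Complex.slitPlane) :
    ∫ s in (0 : ℝ)..1, (z - 1) * (1 + (s : ℂ) * (z - 1))⁻¹ = Complex.log z := by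
  have hmem : ∀ s ∈ Set.uIcc (0 : ℝ) 1, 1 + (s : ℂ) * (z - 1) ∈ Complex.slitPlane := fun s hs ↦
    one_add_smul_sub_one_mem_slitPlane hz (by rwa [Set.uIcc_of_le zero_le_one] at hs)
  rw [intervalIntegral.integral_eq_sub_of_hasDerivAt
    (f := fun s : ℝ ↦ Complex.log (1 + (s : ℂ) * (z - 1)))]
  · simp
  · intro s hs
    have h1 : HasDerivAt (fun s : ℝ ↦ 1 + (s : ℂ) * (z - 1)) (z - 1) s := by
      simpa using ((Complex.ofRealCLM.hasDerivAt (x := s)).mul_const (z - 1)).const_add 1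
    simpa [div_eq_mul_inv] using h1.clog_real (hmem s hs)
  · refine ContinuousOn.intervalIntegrable (ContinuousOn.mul continuousOn_const ?_)
    refine ContinuousOn.inv₀ (by fun_prop) fun s hs ↦ Complex.slitPlane_ne_zero (hmem s hs)

theorem one_add_smul_sub_one_mulVec {M : Matrix m m ℂ} {v : m → ℂ} {z : ℂ} (h : M *ᵥ v = z • v)
    (s : ℝ) : (1 + s • (M - 1)) *ᵥ v = (1 + (s : ℂ) * (z - 1)) • v := by
  rw [Matrix.add_mulVec, Matrix.smul_mulVec, Matrix.sub_mulVec, Matrix.one_mulVec, h, add_smul,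
    mul_smul, sub_smul, one_smul, Complex.coe_smul]

theorem isUnit_one_add_smul_sub_one {M : Matrix m m ℂ}
    (hM : ∀ z ∈ spectrum ℂ M, z ∈ Complex.slitPlane) {s : ℝ} (hs : s ∈ Set.Icc (0 : ℝ) 1) :
    IsUnit (1 + s • (M - 1)) := by
  refine isUnit_of_forall_eigenvector (N := M) ?_ fun v hv w hw h0 ↦ ?_
  · exact (Commute.one_left M).add_left
      ((((Commute.refl M).sub_left (Commute.one_left M))).smul_left s)
  · rw [one_add_smul_sub_one_mulVec hw] at h0
    exact (smul_ne_zero (Complex.slitPlane_ne_zero (one_add_smul_sub_one_mem_slitPlane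
      (hM w (mem_spectrum_of_mulVec_eq hv hw)) hs)) hv) h0

/-- The integral `∫₀¹ (M - 1) (1 + s (M - 1))⁻¹ ds` is a principal logarithm of a matrix `M` with
spectrum in the slit plane, and it commutes with everything that commutes with `M`. -/
theorem exists_isPrincipalLog {M : Matrix m m ℂ}
    (hM : ∀ z ∈ spectrum ℂ M, z ∈ Complex.slitPlane) :
    ∃ L, IsPrincipalLog M L ∧ ∀ N, Commute N M → Commute N L := by
  set g : ℝ → Matrix m m ℂ := fun s ↦ 1 + s • (M - 1) with hg
  set K : ℝ → Matrix m m ℂ := fun s ↦ (M - 1) * Ring.inverse (g s) with hK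
  have hgc : Continuous g := by fun_prop
  have hgu : ∀ s ∈ Set.Icc (0 : ℝ) 1, IsUnit (g s) := fun s hs ↦ isUnit_one_add_smul_sub_one hM hs
  have hopen : IsOpen {s | IsUnit (g s)} := Units.isOpen.preimage hgc
  have hKc : ContinuousOn K {s | IsUnit (g s)} := by
    intro s hs
    obtain ⟨u, hu⟩ := hs
    have h1 : ContinuousAt Ring.inverse (g s) := hu ▸ NormedRing.inverse_continuousAt u
    exact (continuousAt_const.mul (h1.comp hgc.continuousAt)).continuousWithinAt
  have hsub : ∀ r ∈ Set.Icc (0 : ℝ) 1, Set.uIcc 0 r ⊆ Set.Icc (0 : ℝ) 1 := fun r hr ↦ by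
    rw [Set.uIcc_of_le hr.1]; exact Set.Icc_subset_Icc_right hr.2
  have hint : ∀ r ∈ Set.Icc (0 : ℝ) 1, IntervalIntegrable K MeasureTheory.volume 0 r :=
    fun r hr ↦ (hKc.mono fun s hs ↦ hgu s (hsub r hr hs)).intervalIntegrable
  have hcomm : ∀ N, Commute N M → ∀ s, Commute N (K s) := by
    intro N hN s
    have h1 : Commute N (M - 1) := hN.sub_right (Commute.one_right N)
    have h2 : Commute N (g s) := (Commute.one_right N).add_right (h1.smul_right s)
    refine h1.mul_right ?_
    by_cases hu : IsUnit (g s)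
    · obtain ⟨u, hu⟩ := hu
      rw [← hu, Ring.inverse_unit]
      exact (hu ▸ h2 : Commute N u).units_inv_right
    · rw [Ring.inverse_non_unit _ hu]; exact Commute.zero_right N
  have hcommI : ∀ N, Commute N M → ∀ r ∈ Set.Icc (0 : ℝ) 1, Commute N (∫ s in (0 : ℝ)..r, K s) :=
    fun N hN r hr ↦ commute_intervalIntegral (hint r hr) fun s _ ↦ hcomm N hN s
  have hderiv : ∀ r ∈ Set.Icc (0 : ℝ) 1,
      HasDerivAt (fun r ↦ ∫ s in (0 : ℝ)..r, K s) (K r) r := fun r hr ↦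
    intervalIntegral.integral_hasDerivAt_right (hint r hr)
      (hKc.stronglyMeasurableAtFilter hopen r (hgu r hr))
      (hKc.continuousAt (hopen.mem_nhds (hgu r hr)))
  set Λ : ℝ → Matrix m m ℂ := fun r ↦ ∫ s in (0 : ℝ)..r, K s with hΛ
  have hΛcomm : ∀ r ∈ Set.Icc (0 : ℝ) 1, ∀ r' ∈ Set.Icc (0 : ℝ) 1, Commute (Λ r) (Λ r') :=
    fun r hr r' hr' ↦ hcommI _ (hcommI M (Commute.refl M) r hr).symm r' hr'
  have hexp : ∀ r ∈ Set.Icc (0 : ℝ) 1, HasDerivWithinAt (fun r ↦ NormedSpace.exp (-Λ r))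
      (NormedSpace.exp (-Λ r) * -K r) (Set.Icc 0 1) r := by
    intro r hr
    -- Since the values of `Λ` commute, `exp(-Λ x) = exp(-Λ r) exp(Λ r - Λ x)`; only the derivative
    -- of `exp` at `0` is needed.
    have h0 : HasFDerivAt NormedSpace.exp (1 : Matrix m m ℂ →L[ℝ] Matrix m m ℂ) (Λ r - Λ r) := by
      rw [sub_self]; exact hasFDerivAt_exp_zero
    have h1 : HasDerivAt (fun x ↦ NormedSpace.exp (Λ r - Λ x)) (-K r) r := by
      have := h0.comp_hasDerivAt r ((hderiv r hr).const_sub (Λ r))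
      exact this
    refine ((h1.const_mul (NormedSpace.exp (-Λ r))).hasDerivWithinAt).congr_of_mem ?_ hr
    intro x hx
    rw [← Matrix.exp_add_of_commute]
    · congr 1; abel
    · exact (((Commute.refl _).sub_right (hΛcomm r hr x hx)).neg_left)
  have hgd : ∀ r, HasDerivAt g (M - 1) r := fun r ↦ by
    have := ((hasDerivAt_id r).smul_const (M - 1)).const_add (1 : Matrix m m ℂ)
    rw [one_smul] at this
    exact this
  have hprod : ∀ r ∈ Set.Icc (0 : ℝ) 1,
      HasDerivWithinAt (fun r ↦ NormedSpace.exp (-Λ r) * g r) 0 (Set.Icc 0 1) r := by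
    intro r hr
    have h2 := (hexp r hr).mul (hgd r).hasDerivWithinAt
    have h3 : NormedSpace.exp (-Λ r) * -K r * g r + NormedSpace.exp (-Λ r) * (M - 1) = 0 := by
      rw [mul_assoc, neg_mul, show K r * g r = M - 1 from ?_, mul_neg, neg_add_cancel]
      simp only [hK]
      rw [mul_assoc, Ring.inverse_mul_cancel _ (hgu r hr), mul_one]
    rw [h3] at h2
    exact h2
  -- `exp(-Λ r) g(r)` is constant; comparing `r = 0` and `r = 1` gives `exp(-Λ 1) M = 1`.
  have hconst := constant_of_has_deriv_right_zero (fun r hr ↦ (hprod r hr).continuousWithinAt)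
    (fun r hr ↦ (hprod r ⟨hr.1, hr.2.le⟩).mono_of_mem_nhdsWithin
      (Icc_mem_nhdsGE_of_mem hr)) 1 (Set.right_mem_Icc.2 zero_le_one)
  have h1 : (1 : ℝ) ∈ Set.Icc (0 : ℝ) 1 := Set.right_mem_Icc.2 zero_le_one
  refine ⟨Λ 1, ⟨?_, ?_⟩, fun N hN ↦ hcommI N hN 1 h1⟩
  · have h2 : NormedSpace.exp (-Λ 1) * M = 1 := by simpa [hg, hΛ] using hconst
    calc NormedSpace.exp (Λ 1) = NormedSpace.exp (Λ 1) * (NormedSpace.exp (-Λ 1) * M) := by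
          rw [h2, mul_one]
      _ = M := by
          rw [← mul_assoc, ← Matrix.exp_add_of_commute _ _ (Commute.refl (Λ 1)).neg_right,
            add_neg_cancel, NormedSpace.exp_zero, one_mul]
  · intro z hz
    obtain ⟨v, hv, hz, w, hw⟩ := exists_common_eigenvector
      (hcommI M (Commute.refl M) 1 h1).symm hz
    have hwS := hM w (mem_spectrum_of_mulVec_eq hv hw)
    have hKv : ∀ s ∈ Set.uIcc (0 : ℝ) 1, K s *ᵥ v = ((w - 1) * (1 + (s : ℂ) * (w - 1))⁻¹) • v := by
      intro s hs
      have hs' := hsub 1 h1 hs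
      have h3 := mulVec_inverse_of_mulVec_eq (hgu s hs') (Complex.slitPlane_ne_zero
        (one_add_smul_sub_one_mem_slitPlane hwS hs')) (one_add_smul_sub_one_mulVec hw s)
      simp only [hK]
      rw [← Matrix.mulVec_mulVec, h3, Matrix.mulVec_smul, Matrix.sub_mulVec, hw,
        Matrix.one_mulVec, mul_comm (w - 1), mul_smul _ (w - 1), sub_smul w 1, one_smul]
    have h4 : Λ 1 *ᵥ v = Complex.log w • v := by
      rw [hΛ]
      simp only
      rw [intervalIntegral_mulVec (hint 1 h1), intervalIntegral.integral_congr hKv,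
        intervalIntegral.integral_smul_const, intervalIntegral_log hwS]
    have h5 : z = Complex.log w := smul_left_injective ℂ hv (hz.symm.trans h4)
    rw [h5, Complex.log_im, abs_lt]
    exact ⟨Complex.neg_pi_lt_arg w,
      lt_of_le_of_ne (Complex.arg_le_pi w) (Complex.mem_slitPlane_iff_arg.1 hwS).1⟩

/-- The logarithm `N` built as an integral commutes with any other logarithm `L`, so `exp(L - N) =
1`. On a common eigenvector the two eigenvalues have the same exponential and lie in the strip,
hence agree; so `L - N` has only the eigenvalue `0` and vanishes by `eq_zero_of_exp_eq_one`. -/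
theorem isPrincipalLog_unique {M L L' : Matrix m m ℂ} (h : IsPrincipalLog M L)
    (h' : IsPrincipalLog M L') : L = L' := by
  have hM : ∀ z ∈ spectrum ℂ M, z ∈ Complex.slitPlane := by
    intro z hz
    have hc : Commute M L := h.1 ▸ (Commute.refl L).exp_left
    obtain ⟨v, hv, hz, w, hw⟩ := exists_common_eigenvector hc hz
    have h1 := exp_mulVec_of_mulVec_eq hw
    rw [h.1, hz] at h1
    obtain rfl := smul_left_injective ℂ hv h1
    have hw' := abs_lt.1 (h.2 w (mem_spectrum_of_mulVec_eq hv hw))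
    rw [Complex.mem_slitPlane_iff_arg, Complex.arg_exp]
    refine ⟨?_, Complex.exp_ne_zero w⟩
    -- The imaginary part of `w` already lies in `(-π, π)`, so it is the argument of `exp w` and
    -- differs from `π`.
    rw [(toIocMod_eq_self Real.two_pi_pos).2 ⟨hw'.1, by linarith⟩]
    exact hw'.2.ne
  obtain ⟨N, hN, hcomm⟩ := exists_isPrincipalLog hM
  have key : ∀ {L}, IsPrincipalLog M L → L = N := by
    intro L h
    have hc : Commute L N := hcomm L (h.1 ▸ (Commute.refl L).exp_right)
    have hD : NormedSpace.exp (L - N) = 1 := by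
      have h1 : NormedSpace.exp (L - N) * NormedSpace.exp N = NormedSpace.exp N := by
        rw [← Matrix.exp_add_of_commute _ _ (hc.sub_left (Commute.refl N)), sub_add_cancel, h.1,
          hN.1]
      exact (Matrix.isUnit_exp N).mul_eq_right.1 h1
    refine sub_eq_zero.1 (eq_zero_of_exp_eq_one hD fun z hz ↦ ?_)
    obtain ⟨v, hv, hz, w, hw⟩ := exists_common_eigenvector
      (hc.sub_left (Commute.refl N)) hz
    have hL : L *ᵥ v = (z + w) • v := by
      rw [add_smul, ← hz, ← hw, Matrix.sub_mulVec, sub_add_cancel]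
    have h1 := exp_mulVec_of_mulVec_eq hL
    have h2 := exp_mulVec_of_mulVec_eq hw
    rw [h.1] at h1
    rw [hN.1, h1] at h2
    have h3 := smul_left_injective ℂ hv h2
    have h4 := abs_lt.1 (h.2 _ (mem_spectrum_of_mulVec_eq hv hL))
    have h5 := abs_lt.1 (hN.2 _ (mem_spectrum_of_mulVec_eq hv hw))
    have := Complex.exp_inj_of_neg_pi_lt_of_le_pi h4.1 h4.2.le h5.1 h5.2.le h3
    simpa using this
  rw [key h, key h']

theorem isPrincipalLog_principalLog {M : Matrix m m ℂ}
    (hM : ∀ z ∈ spectrum ℂ M, z ∈ Complex.slitPlane) : IsPrincipalLog M (principalLog M) := by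
  obtain ⟨L, hL, -⟩ := exists_isPrincipalLog hM
  have h : ∃ L, IsPrincipalLog M L := ⟨L, hL⟩
  rw [principalLog, dif_pos h]
  exact h.choose_spec

theorem IsPrincipalLog.principalLog_eq {M L : Matrix m m ℂ} (h : IsPrincipalLog M L) :
    principalLog M = L := by
  have h' : ∃ L, IsPrincipalLog M L := ⟨L, h⟩
  rw [principalLog, dif_pos h']
  exact isPrincipalLog_unique h'.choose_spec h

theorem IsPrincipalLog.conj {M L U : Matrix m m ℂ} (h : IsPrincipalLog M L) (hU : IsUnit U) :
    IsPrincipalLog (U * M * U⁻¹) (U * L * U⁻¹) := by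
  refine ⟨by rw [Matrix.exp_conj _ _ hU, h.1], fun z hz ↦ h.2 z ?_⟩
  obtain ⟨u, rfl⟩ := hU
  rwa [← Matrix.coe_units_inv, spectrum.units_conjugate] at hz

theorem IsPrincipalLog.conjTranspose {M L : Matrix m m ℂ} (h : IsPrincipalLog M L) :
    IsPrincipalLog Mᴴ Lᴴ := by
  refine ⟨by rw [Matrix.exp_conjTranspose, h.1], fun z hz ↦ ?_⟩
  rw [← Matrix.star_eq_conjTranspose, spectrum.map_star, Set.mem_star] at hz
  simpa using h.2 _ hz

end PrincipalLog

/-! ### Newton's iteration for the square root of the identity -/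

section NewtonIteration

variable {m : Type*} [Fintype m] [DecidableEq m]

/-- Gelfand's formula bounds `‖E ^ k‖` eventually by `r ^ k` for some `r < 1`. -/
theorem tendsto_pow_zero_of_spectrum {E : Matrix m m ℂ} (hE : ∀ z ∈ spectrum ℂ E, ‖z‖ < 1) :
    Filter.Tendsto (fun k : ℕ ↦ E ^ k) Filter.atTop (nhds 0) := by
  rcases isEmpty_or_nonempty m with hm | hm
  · exact tendsto_const_nhds.congr fun k ↦ Subsingleton.elim _ _
  have h1 : spectralRadius ℂ E < ((1 : NNReal) : ENNReal) :=
    spectrum.spectralRadius_lt_of_forall_lt E fun z hz ↦ by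
      simpa [← NNReal.coe_lt_coe] using hE z hz
  obtain ⟨r, hr1, hr2⟩ := ENNReal.lt_iff_exists_nnreal_btwn.1 h1
  have h2 := (spectrum.pow_nnnorm_pow_one_div_tendsto_nhds_spectralRadius E).eventually_lt_const hr1
  rw [ENNReal.coe_lt_coe] at hr2
  refine squeeze_zero_norm' ?_ (tendsto_pow_atTop_nhds_zero_of_lt_one r.2 (by exact_mod_cast hr2))
  filter_upwards [h2, Filter.eventually_gt_atTop 0] with k hk hk0
  have hk' : (0 : ℝ) < k := by exact_mod_cast hk0
  have h3 := ENNReal.rpow_lt_rpow hk hk'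
  rw [← ENNReal.rpow_mul, one_div, inv_mul_cancel₀ hk'.ne', ENNReal.rpow_one,
    ENNReal.rpow_natCast] at h3
  exact_mod_cast h3.le

theorem re_exp_smul_pos {r : ℝ} (hr : |r| ≤ 1 / 2) {z : ℂ} (hz : |z.im| < Real.pi) :
    0 < (Complex.exp (r • z)).re := by
  rw [Complex.exp_re]
  refine mul_pos (Real.exp_pos _) (Real.cos_pos_of_mem_Ioo (abs_lt.1 ?_))
  rw [Complex.smul_im, smul_eq_mul, abs_mul]
  nlinarith [abs_nonneg r, abs_nonneg z.im]

theorem norm_sub_one_lt_norm_add_one {z : ℂ} (hz : 0 < z.re) : ‖z - 1‖ < ‖z + 1‖ := by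
  rw [← sq_lt_sq₀ (norm_nonneg _) (norm_nonneg _), Complex.sq_norm, Complex.sq_norm,
    Complex.normSq_apply, Complex.normSq_apply]
  simp
  nlinarith

/-- Newton's iteration for the square root of `1`, started at a fractional power
of a matrix, converges to `1`. -/
theorem exists_newton_sequence {L : Matrix m m ℂ} (hL : ∀ z ∈ spectrum ℂ L, |z.im| < Real.pi)
    {r : ℝ} (hr : |r| ≤ 1 / 2) :
    ∃ a : ℕ → Matrix m m ℂ, a 0 = NormedSpace.exp (r • L) ∧ (∀ k, IsUnit (a k)) ∧
      (∀ k, a (k + 1) = (1 / 2 : ℂ) • (a k + (a k)⁻¹)) ∧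
      Filter.Tendsto a Filter.atTop (nhds 1) := by
  set c : Matrix m m ℂ := NormedSpace.exp (r • L) with hc
  have hcL : Commute L c := ((Commute.refl L).smul_right r).exp_right
  have hcv : ∀ v ≠ 0, ∀ w : ℂ, L *ᵥ v = w • v → ∃ s : ℂ, 0 < s.re ∧ c *ᵥ v = s • v := by
    intro v hv w hw
    exact ⟨_, re_exp_smul_pos hr (hL w (mem_spectrum_of_mulVec_eq hv hw)),
      exp_mulVec_of_mulVec_eq (by rw [Matrix.smul_mulVec, hw, smul_assoc])⟩
  have hs1 : ∀ (s : ℂ) (v : m → ℂ), s • v + v = (s + 1) • v := fun s v ↦ by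
    rw [add_smul, one_smul]
  have hc1 : IsUnit (c + 1) := by
    refine isUnit_of_forall_eigenvector (N := L) (hcL.symm.add_left (Commute.one_left L))
      fun v hv w hw h0 ↦ ?_
    obtain ⟨s, hs, hcs⟩ := hcv v hv w hw
    rw [Matrix.add_mulVec, hcs, Matrix.one_mulVec, hs1] at h0
    have := congrArg Complex.re ((smul_eq_zero_iff_left hv).1 h0)
    simp at this
    linarith
  have hdet := (Matrix.isUnit_iff_isUnit_det _).1 hc1
  -- The Cayley transform sends the right half-plane, where the eigenvalues of `c` lie because `|r|
  -- ≤ 1/2`, into the unit disc.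
  set E : Matrix m m ℂ := (c - 1) * (c + 1)⁻¹ with hE
  have hEc : E * (c + 1) = c - 1 := by rw [hE, Matrix.nonsing_inv_mul_cancel_right _ _ hdet]
  have hEL : Commute E L := by
    have h1 : Commute (c + 1) L := hcL.symm.add_left (Commute.one_left L)
    have h2 : Commute (c - 1) L := hcL.symm.sub_left (Commute.one_left L)
    refine h2.mul_left ?_
    obtain ⟨u, hu⟩ := hc1
    rw [← hu, ← Matrix.coe_units_inv]
    exact (hu ▸ h1 : Commute (u : Matrix m m ℂ) L).units_inv_left
  have hEs : ∀ z ∈ spectrum ℂ E, ‖z‖ < 1 := by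
    intro z hz
    obtain ⟨v, hv, hz, w, hw⟩ := exists_common_eigenvector hEL hz
    obtain ⟨s, hs, hcs⟩ := hcv v hv w hw
    have h1 := congrArg (· *ᵥ v) hEc
    simp only [← Matrix.mulVec_mulVec, Matrix.add_mulVec, Matrix.sub_mulVec, hcs,
      Matrix.one_mulVec, Matrix.mulVec_add, Matrix.mulVec_smul, hz] at h1
    have h2 : ((s + 1) * z) • v = (s - 1) • v := by
      rw [sub_smul, one_smul, ← h1, mul_smul, add_smul, one_smul]
    have h3 := congrArg norm (smul_left_injective ℂ hv h2)
    have h4 := norm_sub_one_lt_norm_add_one hs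
    rw [norm_mul] at h3
    by_contra! h5
    nlinarith [norm_nonneg (s + 1)]
  have hEk : ∀ k, ∀ z ∈ spectrum ℂ (E ^ 2 ^ k), ‖z‖ < 1 := by
    intro k z hz
    rw [spectrum.map_pow_of_pos E (by positivity)] at hz
    obtain ⟨w, hw, rfl⟩ := hz
    simpa using pow_lt_one₀ (norm_nonneg w) (hEs w hw) (by positivity)
  have hp : ∀ k, IsUnit (1 + E ^ 2 ^ k) := fun k ↦ by
    refine isUnit_of_forall_eigenvector (N := E ^ 2 ^ k)
      ((Commute.one_left _).add_left (Commute.refl _)) fun v hv w hw h0 ↦ ?_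
    have h1 := hEk k w (mem_spectrum_of_mulVec_eq hv hw)
    rw [Matrix.add_mulVec, hw, Matrix.one_mulVec, add_comm, hs1] at h0
    rw [eq_neg_of_add_eq_zero_left ((smul_eq_zero_iff_left hv).1 h0)] at h1
    simp at h1
  have hq : ∀ k, IsUnit (1 - E ^ 2 ^ k) := fun k ↦ by
    refine isUnit_of_forall_eigenvector (N := E ^ 2 ^ k)
      ((Commute.one_left _).sub_left (Commute.refl _)) fun v hv w hw h0 ↦ ?_
    have h1 := hEk k w (mem_spectrum_of_mulVec_eq hv hw)
    rw [Matrix.sub_mulVec, hw, Matrix.one_mulVec] at h0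
    have h2 : (1 - w) • v = 0 := by rw [sub_smul, one_smul, h0]
    rw [← sub_eq_zero.1 ((smul_eq_zero_iff_left hv).1 h2)] at h1
    simp at h1
  -- Replacing `a` by `(a + a⁻¹) / 2` squares its Cayley transform, so the iterates are the inverse
  -- Cayley transforms of `E ^ 2 ^ k`, which tends to `0`.
  refine ⟨fun k ↦ (1 + E ^ 2 ^ k) * (1 - E ^ 2 ^ k)⁻¹, ?_, ?_, ?_, ?_⟩
  · have hd := (Matrix.isUnit_iff_isUnit_det _).1 (hq 0)
    simp only
    rw [pow_zero, pow_one] at hd ⊢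
    have h1 : c * E = E * c := by
      have : Commute c E := by
        rw [hc]
        exact (hEL.symm.smul_left r).exp_left
      exact this.eq
    have h2 : 1 + E = c * (1 - E) := by
      have : E * c + E = c - 1 := by rw [← hEc, mul_add, mul_one]
      rw [mul_sub, mul_one, h1, eq_sub_of_add_eq this]
      abel
    rw [h2, Matrix.mul_nonsing_inv_cancel_right _ _ hd]
  · exact fun k ↦ (hp k).mul ((Matrix.isUnit_nonsing_inv_iff).2 (hq k))
  · intro k
    simp only
    have hpd := (Matrix.isUnit_iff_isUnit_det _).1 (hp k)
    have hqd := (Matrix.isUnit_iff_isUnit_det _).1 (hq k)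
    have hqd' := (Matrix.isUnit_iff_isUnit_det _).1 (hq (k + 1))
    have hsq : E ^ 2 ^ (k + 1) = E ^ 2 ^ k * E ^ 2 ^ k := by rw [pow_succ 2, pow_mul, sq]
    rw [hsq] at hqd' ⊢
    generalize E ^ 2 ^ k = e at *
    have h1 : (1 - e) * (1 + e) = (1 + e) * (1 - e) := by noncomm_ring
    have h2 : 1 - e * e = (1 - e) * (1 + e) := by noncomm_ring
    have h3 : 1 + e * e = (1 / 2 : ℂ) • ((1 + e) * (1 + e) + (1 - e) * (1 - e)) := by
      have : (1 + e) * (1 + e) + (1 - e) * (1 - e) = (2 : ℂ) • (1 + e * e) := by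
        rw [two_smul]; noncomm_ring
      rw [this, smul_smul]; norm_num
    rw [h2, h3]
    generalize 1 + e = p at *
    generalize 1 - e = q at *
    have h4 : p⁻¹ * q = q * p⁻¹ := by
      calc p⁻¹ * q = p⁻¹ * (q * p) * p⁻¹ := by
            rw [← mul_assoc, Matrix.mul_nonsing_inv_cancel_right _ _ hpd]
        _ = q * p⁻¹ := by rw [h1, Matrix.nonsing_inv_mul_cancel_left _ _ hpd]
    rw [Matrix.mul_inv_rev, Matrix.mul_inv_rev, Matrix.nonsing_inv_nonsing_inv _ hqd, smul_mul_assoc,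
      add_mul]
    congr 2
    · rw [mul_assoc, Matrix.mul_nonsing_inv_cancel_left _ _ hpd]
    · rw [mul_assoc, ← mul_assoc q p⁻¹, ← h4, Matrix.mul_nonsing_inv_cancel_right _ _ hqd, h4]
  · have h1 : Filter.Tendsto (fun k : ℕ ↦ E ^ 2 ^ k) Filter.atTop (nhds 0) :=
      (tendsto_pow_zero_of_spectrum hEs).comp (tendsto_pow_atTop_atTop_of_one_lt one_lt_two)
    have h2 : Filter.Tendsto (fun k : ℕ ↦ 1 - E ^ 2 ^ k) Filter.atTop (nhds 1) := by
      simpa using h1.const_sub 1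
    have h3 : Filter.Tendsto (fun k : ℕ ↦ (1 - E ^ 2 ^ k)⁻¹) Filter.atTop (nhds 1) := by
      simp_rw [Matrix.nonsing_inv_eq_ringInverse]
      have := (NormedRing.inverse_continuousAt (1 : (Matrix m m ℂ)ˣ)).tendsto
      rw [Units.val_one, Ring.inverse_one] at this
      exact this.comp h2
    simpa using (h1.const_add 1).mul h3

end NewtonIteration

/-! ### Accretive pairs: means, midpoints and interpolation -/

section AccretivePair

variable {m : Type*} [Fintype m]

/-- The block matrix `[[A, H], [H*, B]]` is accretive, as a condition on quadratic forms:
`Re (x* A x + y* B y + 2 x* H y) ≥ 0` for all `x`, `y`. -/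
def IsAccretivePair (H A B : Matrix m m ℂ) : Prop :=
  ∀ x y : m → ℂ, 0 ≤ (star x ⬝ᵥ A *ᵥ x + star y ⬝ᵥ B *ᵥ y + 2 * (star x ⬝ᵥ H *ᵥ y)).re

theorem IsAccretivePair.swap {H A B : Matrix m m ℂ} (h : IsAccretivePair H A B) :
    IsAccretivePair Hᴴ B A := by
  intro x y
  have h1 := h y x
  have h2 : star x ⬝ᵥ Hᴴ *ᵥ y = star (star y ⬝ᵥ H *ᵥ x) := by
    rw [Matrix.dotProduct_mulVec, ← Matrix.star_mulVec, Matrix.star_dotProduct]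
  rw [h2]
  simp at h1 ⊢
  linarith

/-- `G` is the harmonic mean of `A₁` and `A₂`. Test the two pairs on `(U x, y)` and `(W x, y)` and
add: as `U x + W x = 2 x`, the first terms add up to `2 x* G x` and the cross terms to twice that of
`(x, y)`. -/
theorem IsAccretivePair.mean_left {H A₁ A₂ B₁ B₂ G U W : Matrix m m ℂ} [DecidableEq m]
    (h₁ : IsAccretivePair H A₁ B₁) (h₂ : IsAccretivePair H A₂ B₂) (hU : A₁ * U = G)
    (hW : A₂ * W = G) (hUW : U + W = (2 : ℂ) • 1) :
    IsAccretivePair H G ((1 / 2 : ℂ) • (B₁ + B₂)) := by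
  intro x y
  have h1 := h₁ (U *ᵥ x) y
  have h2 := h₂ (W *ᵥ x) y
  have hW' : W *ᵥ x = (2 : ℂ) • x - U *ᵥ x := by
    rw [eq_sub_iff_add_eq', ← Matrix.add_mulVec, hUW, Matrix.smul_mulVec, Matrix.one_mulVec]
  rw [Matrix.mulVec_mulVec, hU] at h1
  rw [Matrix.mulVec_mulVec, hW, hW'] at h2
  simp only [star_sub, sub_dotProduct, star_smul, smul_dotProduct, Matrix.smul_mulVec,
    dotProduct_smul, Matrix.add_mulVec, dotProduct_add] at h1 h2 ⊢
  simp at h1 h2 ⊢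
  linarith

theorem continuous_accretivePair_form (H : Matrix m m ℂ) (x y : m → ℂ) :
    Continuous fun p : Matrix m m ℂ × Matrix m m ℂ ↦
      (star x ⬝ᵥ p.1 *ᵥ x + star y ⬝ᵥ p.2 *ᵥ y + 2 * (star x ⬝ᵥ H *ᵥ y)).re :=
  Complex.continuous_re.comp (((continuous_const.dotProduct
    (continuous_fst.matrix_mulVec continuous_const)).add (continuous_const.dotProduct
    (continuous_snd.matrix_mulVec continuous_const))).add continuous_const)

theorem isClosed_isAccretivePair (H : Matrix m m ℂ) :
    IsClosed {p : Matrix m m ℂ × Matrix m m ℂ | IsAccretivePair H p.1 p.2} := by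
  simp only [IsAccretivePair, Set.ofPred_forall]
  exact isClosed_iInter fun x ↦ isClosed_iInter fun y ↦ isClosed_le continuous_const
    (continuous_accretivePair_form H x y)

theorem IsAccretivePair.of_tendsto {H A B : Matrix m m ℂ} {f g : ℕ → Matrix m m ℂ}
    (hf : Filter.Tendsto f Filter.atTop (nhds A)) (hg : Filter.Tendsto g Filter.atTop (nhds B))
    (h : ∀ k, IsAccretivePair H (f k) (g k)) : IsAccretivePair H A B := by
  intro x y
  have h1 := ((continuous_accretivePair_form H x y).tendsto (A, B)).comp (hf.prodMk_nhds hg)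
  exact ge_of_tendsto' h1 fun k ↦ h k x y

variable [DecidableEq m]

theorem IsAccretivePair.newton_step {H F G a b : Matrix m m ℂ} (hb : IsUnit b)
    (hb' : IsUnit ((1 / 2 : ℂ) • (b + b⁻¹))) (h₁ : IsAccretivePair H (F * a) (G * b⁻¹))
    (h₂ : IsAccretivePair H (F * a⁻¹) (G * b)) :
    IsAccretivePair H (F * ((1 / 2 : ℂ) • (a + a⁻¹))) (G * ((1 / 2 : ℂ) • (b + b⁻¹))⁻¹) := by
  have hbd := (Matrix.isUnit_iff_isUnit_det _).1 hb
  have hbd' := (Matrix.isUnit_iff_isUnit_det _).1 hb'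
  set b' := (1 / 2 : ℂ) • (b + b⁻¹) with hb'_def
  have h2 : b + b⁻¹ = (2 : ℂ) • b' := by rw [hb'_def, smul_smul]; norm_num
  -- `G b'⁻¹` is the harmonic mean of `G b⁻¹` and `G b`. The swaps put it in the second slot, with
  -- the arithmetic mean in the first.
  have := (h₁.swap.mean_left h₂.swap (G := G * b'⁻¹) (U := b * b'⁻¹) (W := b⁻¹ * b'⁻¹) ?_ ?_ ?_).swap
  · rwa [Matrix.conjTranspose_conjTranspose, ← mul_add, ← mul_smul_comm] at this
  · rw [mul_assoc, Matrix.nonsing_inv_mul_cancel_left _ _ hbd]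
  · rw [mul_assoc, Matrix.mul_nonsing_inv_cancel_left _ _ hbd]
  · rw [← add_mul, h2, smul_mul_assoc, Matrix.mul_nonsing_inv _ hbd']

/-- Run Newton's iteration in both blocks and keep two pairs coupled, `(F aₖ, G bₖ⁻¹)` and `(F aₖ⁻¹,
G bₖ)`. Each step takes the arithmetic mean in one block and the harmonic mean in the other, and
both pairs converge to `(F, G)`. -/
theorem IsAccretivePair.midpoint {H F G L L' : Matrix m m ℂ}
    (hL : ∀ z ∈ spectrum ℂ L, |z.im| < Real.pi) (hL' : ∀ z ∈ spectrum ℂ L', |z.im| < Real.pi)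
    {r : ℝ} (hr : |r| ≤ 1 / 2)
    (h₁ : IsAccretivePair H (F * NormedSpace.exp (r • L)) (G * NormedSpace.exp (r • L')))
    (h₂ : IsAccretivePair H (F * NormedSpace.exp (-(r • L))) (G * NormedSpace.exp (-(r • L')))) :
    IsAccretivePair H F G := by
  obtain ⟨a, ha0, hau, ha, hat⟩ := exists_newton_sequence hL hr
  -- The exponent `-r` makes `G b₀⁻¹ = G exp(r L')`, matching the first endpoint.
  obtain ⟨b, hb0, hbu, hb, hbt⟩ := exists_newton_sequence hL' (r := -r) (by rwa [abs_neg])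
  have key : ∀ k, IsAccretivePair H (F * a k) (G * (b k)⁻¹) ∧
      IsAccretivePair H (F * (a k)⁻¹) (G * b k) := by
    intro k
    induction k with
    | zero =>
      rw [ha0, hb0, ← Matrix.exp_neg, ← Matrix.exp_neg, neg_smul, neg_neg]
      exact ⟨h₁, h₂⟩
    | succ k ih =>
      have hau' := hau (k + 1)
      have hbu' := hbu (k + 1)
      rw [ha] at hau' ⊢
      rw [hb] at hbu' ⊢
      refine ⟨ih.1.newton_step (hbu k) hbu' ih.2, ?_⟩
      have := (ih.2.swap.newton_step (hau k) hau' ih.1.swap).swap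
      rwa [Matrix.conjTranspose_conjTranspose] at this
  have hbt' : Filter.Tendsto (fun k ↦ (b k)⁻¹) Filter.atTop (nhds 1) := by
    simp_rw [Matrix.nonsing_inv_eq_ringInverse]
    have := (NormedRing.inverse_continuousAt (1 : (Matrix m m ℂ)ˣ)).tendsto
    rw [Units.val_one, Ring.inverse_one] at this
    exact this.comp hbt
  have h1 := hat.const_mul F
  have h2 := hbt'.const_mul G
  rw [mul_one] at h1 h2
  exact IsAccretivePair.of_tendsto h1 h2 fun k ↦ (key k).1

theorem Icc_subset_of_isClosed_of_midpoint_mem {S : Set ℝ} (hS : IsClosed S) (h0 : (0 : ℝ) ∈ S)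
    (h1 : (1 : ℝ) ∈ S)
    (hmid : ∀ s ∈ S, ∀ t ∈ S, 0 ≤ s → s ≤ t → t ≤ 1 → (s + t) / 2 ∈ S) : Set.Icc (0 : ℝ) 1 ⊆ S := by
  intro x hx
  have hc1 : IsCompact (S ∩ Set.Icc 0 x) := isCompact_Icc.inter_left hS
  have hc2 : IsCompact (S ∩ Set.Icc x 1) := isCompact_Icc.inter_left hS
  -- Take the nearest points of `S` on either side of `x`: their midpoint cannot lie strictly
  -- between them, so one of them is `x`.
  obtain ⟨s, hs, hsmax⟩ := hc1.exists_isGreatest ⟨0, h0, le_rfl, hx.1⟩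
  obtain ⟨t, ht, htmin⟩ := hc2.exists_isLeast ⟨1, h1, hx.2, le_rfl⟩
  have hm := hmid s hs.1 t ht.1 hs.2.1 (hs.2.2.trans ht.2.1) ht.2.2
  rcases le_total ((s + t) / 2) x with h | h
  · have := hsmax ⟨hm, by linarith [hs.2.1, ht.2.1, hx.1], h⟩
    have : x = s := by linarith [hs.2.2, ht.2.1]
    exact this ▸ hs.1
  · have := htmin ⟨hm, h, by linarith [hs.2.2, ht.2.2, hx.2]⟩
    have : x = t := by linarith [hs.2.2, ht.2.1]
    exact this ▸ ht.1

theorem exp_add_smul (L : Matrix m m ℂ) (s t : ℝ) :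
    NormedSpace.exp ((s + t) • L) = NormedSpace.exp (s • L) * NormedSpace.exp (t • L) := by
  rw [add_smul, Matrix.exp_add_of_commute]
  exact ((Commute.refl L).smul_left s).smul_right t

/-- Accretive pairs are stable under interpolation along geodesics `A exp(t L)`. -/
theorem IsAccretivePair.interpolate {H A B L L' : Matrix m m ℂ}
    (hL : ∀ z ∈ spectrum ℂ L, |z.im| < Real.pi) (hL' : ∀ z ∈ spectrum ℂ L', |z.im| < Real.pi)
    (h₀ : IsAccretivePair H A B)
    (h₁ : IsAccretivePair H (A * NormedSpace.exp L) (B * NormedSpace.exp L'))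
    {t : ℝ} (ht : t ∈ Set.Icc (0 : ℝ) 1) :
    IsAccretivePair H (A * NormedSpace.exp (t • L)) (B * NormedSpace.exp (t • L')) := by
  refine Icc_subset_of_isClosed_of_midpoint_mem
    (S := {t | IsAccretivePair H (A * NormedSpace.exp (t • L)) (B * NormedSpace.exp (t • L'))})
    ?_ ?_ ?_ ?_ ht
  · exact (isClosed_isAccretivePair H).preimage ((continuous_const.mul (continuous_exp_smul L)).prodMk
      (continuous_const.mul (continuous_exp_smul L')))
  · simpa using h₀
  · simpa using h₁
  · intro s hs u hu h0 hsu h1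
    refine IsAccretivePair.midpoint hL hL' (r := (u - s) / 2)
      (by rw [abs_of_nonneg] <;> linarith) ?_ ?_
    · rw [mul_assoc, mul_assoc, ← exp_add_smul, ← exp_add_smul,
        show (s + u) / 2 + (u - s) / 2 = u by ring]
      exact hu
    · rw [← neg_smul, ← neg_smul, mul_assoc, mul_assoc, ← exp_add_smul, ← exp_add_smul,
        show (s + u) / 2 + -((u - s) / 2) = s by ring]
      exact hs

end AccretivePair

/-! ### Accretive matrices and quadratic forms -/

section Accretive

variable {m : Type*} [Fintype m]

omit [Fintype m] in
theorem isHermitian_realPart (A : Matrix m m ℂ) : (ℜ A : Matrix m m ℂ).IsHermitian :=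
  (ℜ A).2

theorem dotProduct_conjTranspose_mulVec (M : Matrix m m ℂ) (x y : m → ℂ) :
    star x ⬝ᵥ Mᴴ *ᵥ y = star (star y ⬝ᵥ M *ᵥ x) := by
  rw [Matrix.dotProduct_mulVec, ← Matrix.star_mulVec, Matrix.star_dotProduct]

theorem dotProduct_realPart_mulVec (A : Matrix m m ℂ) (x : m → ℂ) :
    star x ⬝ᵥ (ℜ A : Matrix m m ℂ) *ᵥ x = ((star x ⬝ᵥ A *ᵥ x).re : ℂ) := by
  rw [realPart_apply_coe, Matrix.smul_mulVec, dotProduct_smul, Matrix.add_mulVec, dotProduct_add,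
    Matrix.star_eq_conjTranspose, dotProduct_conjTranspose_mulVec, Complex.star_def,
    Complex.add_conj, ← Complex.coe_smul, smul_eq_mul]
  push_cast
  ring

theorem isAccretive_iff {A : Matrix m m ℂ} :
    IsAccretive A ↔ ∀ x : m → ℂ, 0 ≤ (star x ⬝ᵥ A *ᵥ x).re := by
  rw [IsAccretive, Matrix.posSemidef_iff_dotProduct_mulVec]
  simp only [isHermitian_realPart, true_and, dotProduct_realPart_mulVec, Complex.zero_le_real]

theorem isStrictlyAccretive_iff {A : Matrix m m ℂ} :
    IsStrictlyAccretive A ↔ ∀ x : m → ℂ, x ≠ 0 → 0 < (star x ⬝ᵥ A *ᵥ x).re := by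
  rw [IsStrictlyAccretive, Matrix.posDef_iff_dotProduct_mulVec]
  simp only [isHermitian_realPart, true_and, dotProduct_realPart_mulVec, Complex.zero_lt_real]

omit [Fintype m] in
theorem Matrix.PosDef.coe_realPart {P : Matrix m m ℂ} (hP : P.PosDef) :
    (ℜ P : Matrix m m ℂ) = P :=
  IsSelfAdjoint.coe_realPart hP.isHermitian

theorem Matrix.PosDef.isStrictlyAccretive {P : Matrix m m ℂ} (hP : P.PosDef) :
    IsStrictlyAccretive P := by
  rwa [IsStrictlyAccretive, hP.coe_realPart]

theorem star_dotProduct_conj_mulVec (A U W : Matrix m m ℂ) (x y : m → ℂ) :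
    star x ⬝ᵥ (Uᴴ * A * W) *ᵥ y = star (U *ᵥ x) ⬝ᵥ A *ᵥ (W *ᵥ y) := by
  rw [← Matrix.mulVec_mulVec, ← Matrix.mulVec_mulVec, Matrix.dotProduct_mulVec,
    ← Matrix.star_mulVec]

theorem IsAccretivePair.conj {H A B : Matrix m m ℂ} (h : IsAccretivePair H A B)
    (U W : Matrix m m ℂ) : IsAccretivePair (Uᴴ * H * W) (Uᴴ * A * U) (Wᴴ * B * W) := by
  intro x y
  simp only [star_dotProduct_conj_mulVec]
  exact h _ _

theorem isAccretivePair_iff_posSemidef {H A B : Matrix m m ℂ} :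
    IsAccretivePair H A B ↔
      (Matrix.fromBlocks (ℜ A : Matrix m m ℂ) H Hᴴ (ℜ B : Matrix m m ℂ)).PosSemidef := by
  have key : ∀ x y : m → ℂ, star (Sum.elim x y) ⬝ᵥ
      (Matrix.fromBlocks (ℜ A : Matrix m m ℂ) H Hᴴ (ℜ B : Matrix m m ℂ)) *ᵥ Sum.elim x y =
      ((star x ⬝ᵥ A *ᵥ x + star y ⬝ᵥ B *ᵥ y + 2 * (star x ⬝ᵥ H *ᵥ y)).re : ℂ) := by
    intro x y
    have h1 : star (Sum.elim x y) = Sum.elim (star x) (star y) := by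
      ext (i | i) <;> rfl
    rw [Matrix.fromBlocks_mulVec, h1, sumElim_dotProduct_sumElim, Sum.elim_comp_inl,
      Sum.elim_comp_inr, dotProduct_add, dotProduct_add, dotProduct_realPart_mulVec,
      dotProduct_realPart_mulVec, dotProduct_conjTranspose_mulVec, Complex.star_def]
    have h2 := Complex.add_conj (star x ⬝ᵥ H *ᵥ y)
    rw [Complex.add_re, Complex.add_re, ← Complex.ofReal_ofNat, Complex.re_ofReal_mul]
    push_cast at h2 ⊢
    linear_combination h2
  rw [Matrix.posSemidef_iff_dotProduct_mulVec]
  constructor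
  · intro h
    refine ⟨Matrix.IsHermitian.fromBlocks (isHermitian_realPart A) rfl (isHermitian_realPart B),
      fun z ↦ ?_⟩
    rw [← Sum.elim_comp_inl_inr z, key, Complex.zero_le_real]
    exact h _ _
  · intro h x y
    have := h.2 (Sum.elim x y)
    rwa [key, Complex.zero_le_real] at this

variable [DecidableEq m]

theorem IsStrictlyAccretive.mem_slitPlane {A : Matrix m m ℂ} (hA : IsStrictlyAccretive A) :
    ∀ z ∈ spectrum ℂ A, z ∈ Complex.slitPlane := by
  intro z hz
  obtain ⟨v, hv, h⟩ := exists_eigenvector hz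
  have h1 := isStrictlyAccretive_iff.1 hA v hv
  rw [h, dotProduct_smul, smul_eq_mul] at h1
  have h2 : star v ⬝ᵥ v = ((star v ⬝ᵥ v).re : ℂ) :=
    Complex.eq_re_of_ofReal_le (r := 0) (by simp)
  have h3 : 0 ≤ (star v ⬝ᵥ v).re := (Complex.nonneg_iff.1 (by simp)).1
  rw [h2, Complex.re_mul_ofReal] at h1
  exact Or.inl (pos_of_mul_pos_left h1 h3)

theorem IsStrictlyAccretive.isUnit {A : Matrix m m ℂ} (hA : IsStrictlyAccretive A) : IsUnit A := by
  by_contra h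
  exact Complex.slitPlane_ne_zero (hA.mem_slitPlane 0 ((spectrum.zero_mem_iff ℂ).2 h)) rfl

theorem IsStrictlyAccretive.conj {A U : Matrix m m ℂ} (hA : IsStrictlyAccretive A)
    (hU : IsUnit U) : IsStrictlyAccretive (Uᴴ * A * U) := by
  rw [isStrictlyAccretive_iff] at hA ⊢
  intro x hx
  rw [star_dotProduct_conj_mulVec]
  refine hA _ fun h ↦ hx ?_
  exact Matrix.mulVec_injective_of_isUnit hU (by simpa using h)

/-- An eigenvector satisfies `B v = z A v`. If `z` were real and nonpositive, the real parts of `v*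
A v` and `v* B v` could not both be positive. -/
theorem inv_mul_mem_slitPlane {A B : Matrix m m ℂ} (hA : IsStrictlyAccretive A)
    (hB : IsStrictlyAccretive B) : ∀ z ∈ spectrum ℂ (A⁻¹ * B), z ∈ Complex.slitPlane := by
  intro z hz
  obtain ⟨v, hv, h⟩ := exists_eigenvector hz
  have hBv : B *ᵥ v = z • (A *ᵥ v) := by
    rw [← Matrix.mulVec_smul, ← h, Matrix.mulVec_mulVec,
      Matrix.mul_nonsing_inv_cancel_left _ _ ((Matrix.isUnit_iff_isUnit_det _).1 hA.isUnit)]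
  have h1 := isStrictlyAccretive_iff.1 hA v hv
  have h2 := isStrictlyAccretive_iff.1 hB v hv
  rw [hBv, dotProduct_smul, smul_eq_mul, Complex.mul_re] at h2
  by_contra h3
  rw [Complex.mem_slitPlane_iff, not_or, not_lt, not_not] at h3
  rw [h3.2] at h2
  nlinarith

end Accretive

/-! ### Weighted geometric means and the extremal property -/

section GeomMean

variable {m : Type*} [Fintype m] [DecidableEq m]

theorem IsPrincipalLog.principalPow_eq {M L : Matrix m m ℂ} (h : IsPrincipalLog M L) (t : ℝ) :
    principalPow M t = NormedSpace.exp (t • L) := by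
  rw [principalPow, h.principalLog_eq]

/-- With `R = A^(1/2)`, the inner factor `R⁻¹ B R⁻¹` is the conjugate `R (A⁻¹ B) R⁻¹`, and the
principal logarithm respects similarity. -/
theorem geomMean_eq {A B L : Matrix m m ℂ} (hA : IsStrictlyAccretive A)
    (hL : IsPrincipalLog (A⁻¹ * B) L) (t : ℝ) : geomMean t A B = A * NormedSpace.exp (t • L) := by
  have hlog := isPrincipalLog_principalLog hA.mem_slitPlane
  set R := NormedSpace.exp ((1 / 2 : ℝ) • principalLog A) with hR
  have hRu : IsUnit R := Matrix.isUnit_exp _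
  have hRd := (Matrix.isUnit_iff_isUnit_det _).1 hRu
  have hRR : R * R = A := by
    rw [hR, ← exp_add_smul, add_halves, one_smul, hlog.1]
  have hRinv : principalPow A (-(1 / 2)) = R⁻¹ := by
    rw [hlog.principalPow_eq, neg_smul, Matrix.exp_neg]
  have hmid : R⁻¹ * B * R⁻¹ = R * (A⁻¹ * B) * R⁻¹ := by
    rw [← hRR, Matrix.mul_inv_rev, mul_assoc R⁻¹ R⁻¹ B, Matrix.mul_nonsing_inv_cancel_left _ _ hRd]
  rw [geomMean, hRinv, hlog.principalPow_eq, ← hR, hmid, (hL.conj hRu).principalPow_eq,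
    ← smul_mul_assoc, ← mul_smul_comm, Matrix.exp_conj _ _ hRu, ← mul_assoc, ← mul_assoc,
    Matrix.nonsing_inv_mul_cancel_right _ _ hRd, hRR]

theorem geomMean_isAccretivePair {H A B : Matrix m m ℂ} (hA : IsStrictlyAccretive A)
    (hB : IsStrictlyAccretive B) (hH : H.IsHermitian) (h : IsAccretivePair H A B) {t : ℝ}
    (ht : t ∈ Set.Icc (0 : ℝ) 1) :
    IsAccretivePair H (geomMean t A B) (geomMean (1 - t) A B) := by
  have hL := isPrincipalLog_principalLog (inv_mul_mem_slitPlane hA hB)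
  set L := principalLog (A⁻¹ * B)
  have hAL : A * NormedSpace.exp L = B := by
    rw [hL.1, Matrix.mul_nonsing_inv_cancel_left _ _ ((Matrix.isUnit_iff_isUnit_det _).1 hA.isUnit)]
  have hBL : B * NormedSpace.exp (-L) = A := by
    rw [← hAL, Matrix.exp_neg, Matrix.mul_nonsing_inv_cancel_right _ _
      ((Matrix.isUnit_iff_isUnit_det _).1 (Matrix.isUnit_exp L))]
  have hB' : B * NormedSpace.exp (t • -L) = geomMean (1 - t) A B := by
    have : B = A * NormedSpace.exp ((1 : ℝ) • L) := by rw [one_smul, hAL]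
    rw [geomMean_eq hA hL, sub_eq_add_neg, exp_add_smul, ← mul_assoc, ← this, smul_neg, neg_smul]
  rw [geomMean_eq hA hL, ← hB']
  refine IsAccretivePair.interpolate hL.2 (fun z hz ↦ ?_) h ?_ ht
  · rw [← spectrum.neg_eq, Set.mem_neg] at hz
    simpa using hL.2 _ hz
  -- The endpoint `t = 1` is the swapped pair `(B, A)`; this is where `H` has to be Hermitian.
  · rw [hAL, hBL]
    have := h.swap
    rwa [hH.eq] at this

theorem isAccretivePair_one_iff {A R : Matrix m m ℂ} (hR : R.PosDef) :
    IsAccretivePair 1 A R ↔ ((ℜ A : Matrix m m ℂ) - R⁻¹).PosSemidef := by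
  let _ := hR.isUnit.invertible
  have := Matrix.PosDef.fromBlocks₂₂ (ℜ A : Matrix m m ℂ) 1 hR
  rw [isAccretivePair_iff_posSemidef, hR.coe_realPart, this]
  simp

/-- By Schur complements, `1` couples `C` with a positive definite `R` exactly when `Re C ≥ R⁻¹`.
The choice `R = (Re A)⁻¹ + (Re B)⁻¹` works for both `A` and `B`; interpolating with `R` held
constant (`L' = 0`) gives `Re(A ♯_t B) ≥ R⁻¹ > 0`. -/
theorem IsStrictlyAccretive.geomMean {A B : Matrix m m ℂ} (hA : IsStrictlyAccretive A)
    (hB : IsStrictlyAccretive B) {t : ℝ} (ht : t ∈ Set.Icc (0 : ℝ) 1) :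
    IsStrictlyAccretive (geomMean t A B) := by
  have hL := isPrincipalLog_principalLog (inv_mul_mem_slitPlane hA hB)
  set L := principalLog (A⁻¹ * B)
  have hAL : A * NormedSpace.exp L = B := by
    rw [hL.1, Matrix.mul_nonsing_inv_cancel_left _ _ ((Matrix.isUnit_iff_isUnit_det _).1 hA.isUnit)]
  set R : Matrix m m ℂ := (ℜ A : Matrix m m ℂ)⁻¹ + (ℜ B : Matrix m m ℂ)⁻¹
  have hR : R.PosDef := hA.inv.add hB.inv
  have key : ∀ C : Matrix m m ℂ, IsStrictlyAccretive C → (R - (ℜ C : Matrix m m ℂ)⁻¹).PosSemidef →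
      IsAccretivePair 1 C R := by
    intro C hC hRC
    let _ := Matrix.PosDef.isUnit hC |>.invertible
    rw [isAccretivePair_iff_posSemidef, hR.coe_realPart,
      Matrix.PosDef.fromBlocks₁₁ (1 : Matrix m m ℂ) R hC]
    simpa using hRC
  have hA1 : IsAccretivePair 1 A R := key A hA (by simpa [R] using hB.inv.posSemidef)
  have hB1 : IsAccretivePair 1 B R := key B hB (by simpa [R] using hA.inv.posSemidef)
  have h := IsAccretivePair.interpolate (L := L) (L' := 0) hL.2 (fun z hz ↦ ?_) hA1
    (by simpa [hAL] using hB1) ht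
  · rw [smul_zero, NormedSpace.exp_zero, mul_one, ← geomMean_eq hA hL,
      isAccretivePair_one_iff hR] at h
    have := Matrix.PosDef.posSemidef_add h hR.inv
    rwa [sub_add_cancel] at this
  · rcases isEmpty_or_nonempty m with hm | hm
    · simp [spectrum.of_subsingleton] at hz
    · rw [spectrum.zero_eq, Set.mem_singleton_iff] at hz
      simpa [hz] using Real.pi_pos

theorem Matrix.PosDef.isHermitian_principalLog {P : Matrix m m ℂ} (hP : P.PosDef) :
    (principalLog P).IsHermitian := by
  have h := isPrincipalLog_principalLog hP.isStrictlyAccretive.mem_slitPlane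
  have h' := h.conjTranspose
  rw [hP.isHermitian.eq] at h'
  exact isPrincipalLog_unique h' h

theorem Matrix.PosDef.isHermitian_principalPow {P : Matrix m m ℂ} (hP : P.PosDef) (t : ℝ) :
    (principalPow P t).IsHermitian :=
  (hP.isHermitian_principalLog.smul (IsSelfAdjoint.all t)).exp

theorem principalPow_add {P : Matrix m m ℂ} (s t : ℝ) :
    principalPow P (s + t) = principalPow P s * principalPow P t :=
  exp_add_smul _ _ _

theorem Matrix.PosDef.posSemidef_principalPow {P : Matrix m m ℂ} (hP : P.PosDef) (t : ℝ) :
    (principalPow P t).PosSemidef := by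
  have := Matrix.posSemidef_conjTranspose_mul_self (principalPow P (t / 2))
  rwa [(hP.isHermitian_principalPow _).eq, ← principalPow_add, add_halves] at this

theorem Matrix.PosDef.principalPow_one {P : Matrix m m ℂ} (hP : P.PosDef) :
    principalPow P 1 = P := by
  rw [principalPow, one_smul,
    (isPrincipalLog_principalLog hP.isStrictlyAccretive.mem_slitPlane).1]

/-- The geometric mean of positive definite `P`, `Q` is at least every positive semidefinite `H`
for which the block matrix `[[P, H], [H, Q]]` is positive semidefinite. -/
theorem le_geomMean_half {P Q H : Matrix m m ℂ} (hP : P.PosDef) (hQ : Q.PosDef)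
    (hH : H.PosSemidef) (h : IsAccretivePair H P Q) : H ≤ geomMean (1 / 2) P Q := by
  set R := principalPow P (1 / 2) with hR
  have hRh : Rᴴ = R := (hP.isHermitian_principalPow _).eq
  have hRu : IsUnit R := Matrix.isUnit_exp _
  have hRd := (Matrix.isUnit_iff_isUnit_det _).1 hRu
  have hRR : R * R = P := by
    rw [hR, ← principalPow_add, add_halves, hP.principalPow_one]
  have hRinv : principalPow P (-(1 / 2)) = R⁻¹ := by
    rw [hR, principalPow, neg_smul, Matrix.exp_neg, principalPow]
  have hRinvh : (R⁻¹)ᴴ = R⁻¹ := by rw [Matrix.conjTranspose_nonsing_inv, hRh]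
  set K := R⁻¹ * Q * R⁻¹ with hK
  have hKpos : K.PosDef := by
    have := hQ.isStrictlyAccretive.conj ((Matrix.isUnit_nonsing_inv_iff).2 hRu)
    rw [hRinvh, IsStrictlyAccretive, IsSelfAdjoint.coe_realPart] at this
    · exact this
    · rw [isSelfAdjoint_iff, Matrix.star_eq_conjTranspose, Matrix.conjTranspose_mul,
        Matrix.conjTranspose_mul, hRinvh, hQ.isHermitian.eq, mul_assoc]
  set N := R⁻¹ * H * R⁻¹ with hN
  have hNpos : N.PosSemidef := by
    have := hH.conjTranspose_mul_mul_same R⁻¹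
    rwa [hRinvh] at this
  -- The Schur complement gives `H P⁻¹ H ≤ Q`; conjugation by `R⁻¹ = P^(-1/2)` turns it into `N² ≤
  -- K`.
  have hNK : N * N ≤ K := by
    let _ := hP.isUnit.invertible
    rw [isAccretivePair_iff_posSemidef, hP.coe_realPart, hQ.coe_realPart,
      Matrix.PosDef.fromBlocks₁₁ H Q hP] at h
    have h1 := h.conjTranspose_mul_mul_same R⁻¹
    rw [Matrix.le_iff]
    have h2 : K - N * N = (R⁻¹)ᴴ * (Q - Hᴴ * P⁻¹ * H) * R⁻¹ := by
      rw [hRinvh, hH.isHermitian.eq, mul_sub, sub_mul, hK, hN, ← hRR, Matrix.mul_inv_rev]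
      simp only [mul_assoc]
    rw [h2]
    exact h1
  -- The square root is operator monotone, and `N ≥ 0` is the square root of `N²`.
  have hNS : N ≤ principalPow K (1 / 2) := by
    have h1 := CFC.sqrt_le_sqrt _ _ hNK
    have h2 : principalPow K (1 / 2) * principalPow K (1 / 2) = K := by
      rw [← principalPow_add, add_halves, hKpos.principalPow_one]
    rwa [CFC.sqrt_mul_self N hNpos.nonneg,
      CFC.sqrt_unique h2 (hKpos.posSemidef_principalPow _).nonneg] at h1
  have h3 := (Matrix.le_iff.1 hNS).conjTranspose_mul_mul_same R
  rw [geomMean, hRinv, ← hR, Matrix.le_iff]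
  have h4 : R * N * R = H := by
    rw [hN, mul_assoc R⁻¹, Matrix.mul_nonsing_inv_cancel_left _ _ hRd,
      Matrix.nonsing_inv_mul_cancel_right _ _ hRd]
  rw [hRh, mul_sub, sub_mul, h4] at h3
  exact h3

theorem isAccretivePair_realPart_iff {H A B : Matrix m m ℂ} :
    IsAccretivePair H (ℜ A : Matrix m m ℂ) (ℜ B : Matrix m m ℂ) ↔ IsAccretivePair H A B := by
  rw [isAccretivePair_iff_posSemidef, isAccretivePair_iff_posSemidef,
    IsSelfAdjoint.coe_realPart (ℜ A).2, IsSelfAdjoint.coe_realPart (ℜ B).2]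

theorem IsAccretivePair.le_geomMean_realPart {H A B : Matrix m m ℂ} (hA : IsStrictlyAccretive A)
    (hB : IsStrictlyAccretive B) (hH : H.PosSemidef) (h : IsAccretivePair H A B) {t : ℝ}
    (ht : t ∈ Set.Icc (0 : ℝ) 1) :
    H ≤ geomMean (1 / 2) (ℜ (geomMean t A B) : Matrix m m ℂ)
      (ℜ (geomMean (1 - t) A B) : Matrix m m ℂ) :=
  le_geomMean_half (hA.geomMean hB ht)
    (hA.geomMean hB ⟨sub_nonneg.2 ht.2, sub_le_self 1 ht.1⟩) hH
    (isAccretivePair_realPart_iff.2 (geomMean_isAccretivePair hA hB hH.isHermitian h ht))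

end GeomMean

/-! ### From the block matrix to a Hermitian coupling -/

section PolarDecomposition

variable {m : Type*} [Fintype m] [DecidableEq m]

omit [DecidableEq m] in
-- In the real part of the form of the partial transpose, `y* X x` can be replaced by its conjugate
-- `x* Xᴴ y`, so the off-diagonal terms combine to `x* (X + Y)ᴴ y`.
theorem isAccretivePair_of_isAPT {A B X Y : Matrix m m ℂ}
    (h : IsAPT (Matrix.fromBlocks A X Yᴴ B)) :
    IsAccretivePair ((1 / 2 : ℂ) • (X + Y))ᴴ A B := by
  intro x y
  have h1 := isAccretive_iff.1 h.2 (Sum.elim x y)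
  have h2 : star (Sum.elim x y) = Sum.elim (star x) (star y) := by
    ext (i | i) <;> rfl
  simp only [partialTranspose, Matrix.toBlocks_fromBlocks₁₁, Matrix.toBlocks_fromBlocks₁₂,
    Matrix.toBlocks_fromBlocks₂₁, Matrix.toBlocks_fromBlocks₂₂] at h1
  rw [Matrix.fromBlocks_mulVec, h2, sumElim_dotProduct_sumElim, Sum.elim_comp_inl,
      Sum.elim_comp_inr, dotProduct_add, dotProduct_add, dotProduct_conjTranspose_mulVec] at h1
  rw [dotProduct_conjTranspose_mulVec, Matrix.smul_mulVec, Matrix.add_mulVec, dotProduct_smul,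
    dotProduct_add]
  simp at h1 ⊢
  linarith

theorem abs_conjTranspose_of_polar {Z V : Matrix m m ℂ} (hV : V ∈ Matrix.unitaryGroup m ℂ)
    (h : Z = V * CFC.abs Z) : CFC.abs Zᴴ = V * CFC.abs Z * Vᴴ := by
  have hpos : (CFC.abs Z).PosSemidef := Matrix.nonneg_iff_posSemidef.1 (CFC.abs_nonneg Z)
  have hVV : Vᴴ * V = 1 := Matrix.mem_unitaryGroup_iff'.1 hV
  refine CFC.sqrt_unique ?_ (hpos.mul_mul_conjTranspose_same V).nonneg
  rw [Matrix.star_eq_conjTranspose, Matrix.conjTranspose_conjTranspose]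
  have h1 : Zᴴ = CFC.abs Z * Vᴴ := by
    conv_lhs => rw [h, Matrix.conjTranspose_mul, hpos.isHermitian.eq]
  calc V * CFC.abs Z * Vᴴ * (V * CFC.abs Z * Vᴴ)
      = V * CFC.abs Z * (Vᴴ * V) * (CFC.abs Z * Vᴴ) := by simp only [mul_assoc]
    _ = Z * Zᴴ := by rw [hVV, mul_one, h1, ← h]

end PolarDecomposition

theorem mainTheorem9 (n : ℕ) (A B X Y V : Matrix (Fin n) (Fin n) ℂ)
    (hA : IsStrictlyAccretive A) (hB : IsStrictlyAccretive B)
    (hM : IsAPT (Matrix.fromBlocks A X Yᴴ B))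
    (hV : V ∈ Matrix.unitaryGroup (Fin n) ℂ)
    (hpolar : (1 / 2 : ℂ) • (X + Y) = V * CFC.abs ((1 / 2 : ℂ) • (X + Y)))
    (t : ℝ) (ht : t ∈ Set.Icc (0 : ℝ) 1) :
    CFC.abs ((1 / 2 : ℂ) • (X + Y)) ≤
        geomMean (1 / 2)
          (ℜ (geomMean t A (Vᴴ * B * V)) : Matrix (Fin n) (Fin n) ℂ)
          (ℜ (geomMean (1 - t) A (Vᴴ * B * V)) : Matrix (Fin n) (Fin n) ℂ) ∧
      CFC.abs ((1 / 2 : ℂ) • (Xᴴ + Yᴴ)) ≤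
        geomMean (1 / 2)
          (ℜ (geomMean t (V * A * Vᴴ) B) : Matrix (Fin n) (Fin n) ℂ)
          (ℜ (geomMean (1 - t) (V * A * Vᴴ) B) : Matrix (Fin n) (Fin n) ℂ) := by
  have hpair := isAccretivePair_of_isAPT hM
  have hstar : (1 / 2 : ℂ) • (Xᴴ + Yᴴ) = ((1 / 2 : ℂ) • (X + Y))ᴴ := by
    rw [Matrix.conjTranspose_smul, Matrix.conjTranspose_add]
    simp
  rw [hstar]
  generalize (1 / 2 : ℂ) • (X + Y) = Z at *
  have hVV : Vᴴ * V = 1 := Matrix.mem_unitaryGroup_iff'.1 hV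
  have hVV' : V * Vᴴ = 1 := Matrix.mem_unitaryGroup_iff.1 hV
  have hVu : IsUnit V := IsUnit.of_mul_eq_one _ hVV'
  have hVu' : IsUnit Vᴴ := IsUnit.of_mul_eq_one _ hVV
  have hpos : (CFC.abs Z).PosSemidef := Matrix.nonneg_iff_posSemidef.1 (CFC.abs_nonneg Z)
  have hZ : Zᴴ = CFC.abs Z * Vᴴ := by
    conv_lhs => rw [hpolar, Matrix.conjTranspose_mul, hpos.isHermitian.eq]
  -- Congruence by `diag(1, V)` removes the unitary factor, since `Zᴴ V = |Z|`.
  have h1 : IsAccretivePair (CFC.abs Z) A (Vᴴ * B * V) := by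
    have := hpair.conj 1 V
    rwa [hZ, Matrix.conjTranspose_one, one_mul, one_mul, mul_one, mul_assoc, hVV, mul_one] at this
  have h2 : IsAccretivePair (CFC.abs Zᴴ) (V * A * Vᴴ) B := by
    have := h1.conj Vᴴ Vᴴ
    rwa [Matrix.conjTranspose_conjTranspose, ← abs_conjTranspose_of_polar hV hpolar,
      show V * (Vᴴ * B * V) * Vᴴ = (V * Vᴴ) * B * (V * Vᴴ) by simp only [mul_assoc], hVV',
      one_mul, mul_one] at this
  have hVA : IsStrictlyAccretive (V * A * Vᴴ) := by
    have := hA.conj hVu'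
    rwa [Matrix.conjTranspose_conjTranspose] at this
  exact ⟨h1.le_geomMean_realPart hA (hB.conj hVu) hpos ht,
    h2.le_geomMean_realPart hVA hB (Matrix.nonneg_iff_posSemidef.1 (CFC.abs_nonneg _)) ht⟩
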